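/- Let $X=[\mathbf x_1,\dots,\mathbf x_p]$ be a fixed real $n\times p$ matrix of full column rank, $\operatorname{rank}(X)=p$, and fix $\lambda\ge 0$. For every $y\in\mathbb R^n$ the lasso criterion $$\Big\|y-\sum_{j=1}^p \mathbf x_j\beta_j\Big\|^2+\lambda\sum_{j=1}^p|\beta_j|\qquad(\beta\in\mathbb R^p)$$ has a unique minimizer $\hat\beta_\lambda(y)$. Let $\hat\mu_\lambda(y)=X\hat\beta_\lambda(y)$ be the lasso fit and $\mathcal B_\lambda(y)=\{j:\hat\beta_\lambda(y)_j\ne 0\}$ the active set. Then $y\mapsto\hat\mu_\lambda(y)$ is a uniformly Lipschitz function on $\mathbb R^n$, with Lipschitz constant $1$ for the Euclidean norm: $\|\hat\mu_\lambda(y)-\hat\mu_\lambda(y')\|\le\|y-y'\|$ for all $y,y'\in\mathbb R^n$. Moreover, if $y$ is random with $y\sim N(\mu,\sigma^2 I_n)$ for some $\mu\in\mathbb R^n$ and $\sigma>0$, then all $y_i$ and $\hat\mu_\lambda(y)_i$ are square integrable, $|\mathcal B_\lambda(y)|$ is integrable, and the degrees of freedom of the lasso fit equal the expected number of nonzero lasso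 coefficients: $$df(\lambda):=\sum_{i=1}^n\frac{\operatorname{cov}\big(\hat\mu_\lambda(y)_i,\,y_i\big)}{\sigma^2}=E\,|\mathcal B_\lambda(y)|.$$ That is, $|\mathcal B_\lambda(y)|$ is an exactly unbiased estimator of $df(\lambda)$. -/

import Mathlib

open MeasureTheory ProbabilityTheory

noncomputable section

/-- The lasso criterion `‖y - X β‖² + lam * ∑ j, |β j|`, with the Euclidean norm on `ℝⁿ`. -/
def lassoObjective {n p : ℕ} (X : Matrix (Fin n) (Fin p) ℝ) (lam : ℝ)
    (y : EuclideanSpace ℝ (Fin n)) (β : Fin p → ℝ) : ℝ :=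
  ‖y - WithLp.toLp 2 (X.mulVec β)‖ ^ 2 + lam * ∑ j, |β j|

/-- `β` is a global minimizer of the lasso criterion. -/
def IsLassoEstimate {n p : ℕ} (X : Matrix (Fin n) (Fin p) ℝ) (lam : ℝ)
    (y : EuclideanSpace ℝ (Fin n)) (β : Fin p → ℝ) : Prop :=
  ∀ γ : Fin p → ℝ, lassoObjective X lam y β ≤ lassoObjective X lam y γ

/-- The lasso coefficient vector, the argmin of the lasso criterion. (It is arbitrary if there is
no minimizer, and some minimizer if there are several.) -/
def lassoCoef {n p : ℕ} (X : Matrix (Fin n) (Fin p) ℝ) (lam : ℝ)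
    (y : EuclideanSpace ℝ (Fin n)) : Fin p → ℝ :=
  Classical.epsilon (IsLassoEstimate X lam y)

/-- The lasso fit `X β̂`. -/
def lassoFit {n p : ℕ} (X : Matrix (Fin n) (Fin p) ℝ) (lam : ℝ)
    (y : EuclideanSpace ℝ (Fin n)) : EuclideanSpace ℝ (Fin n) :=
  WithLp.toLp 2 (X.mulVec (lassoCoef X lam y))

/-- The active set of the lasso: the indices of its nonzero coefficients. -/
def lassoActiveSet {n p : ℕ} (X : Matrix (Fin n) (Fin p) ℝ) (lam : ℝ)
    (y : EuclideanSpace ℝ (Fin n)) : Finset (Fin p) :=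
  Finset.univ.filter fun j => lassoCoef X lam y j ≠ 0

/-- The degrees of freedom `∑ i, cov(δ(y)_i, y_i) / σ²` of a fitting procedure `δ` applied to a
random response vector `y` with noise level `σ`. -/
def degreesOfFreedom {n : ℕ} {Ω : Type*} [MeasurableSpace Ω] (P : Measure Ω) (σ : ℝ)
    (δ : EuclideanSpace ℝ (Fin n) → EuclideanSpace ℝ (Fin n))
    (y : Ω → EuclideanSpace ℝ (Fin n)) : ℝ :=
  ∑ i, covariance (fun ω => δ (y ω) i) (fun ω => y ω i) P / σ ^ 2

end

/-! Minimizers are characterized by a variational inequality; adding it for two responses makes the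
fit nonexpansive, hence each coefficient Lipschitz (`IsLassoEstimate.norm_sub_le`). No local
constancy of the active set is used. Instead, write `xₖ` for the columns of `X`: as long as the k-th
coefficient keeps its sign, moving `y` along `xₖ` changes that coefficient alone, at unit rate
(`IsLassoEstimate.add_smul_single`). On every line parallel to `xₖ` its derivative is therefore a.e.
the indicator of being nonzero, and Stein's lemma in the direction `xₖ` gives `cov(β̂ₖ, ⟨xₖ, y⟩) =
σ² P(β̂ₖ ≠ 0)`. Since `∑ᵢ cov(μ̂ᵢ, yᵢ) = ∑ₖ cov(β̂ₖ, ⟨xₖ, y⟩)`, summing over k gives the theorem. -/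

/-- The linear map `β ↦ X β` into Euclidean space. -/
noncomputable def fitMap {n p : ℕ} (X : Matrix (Fin n) (Fin p) ℝ) :
    (Fin p → ℝ) →ₗ[ℝ] EuclideanSpace ℝ (Fin n) :=
  (WithLp.linearEquiv 2 ℝ (Fin n → ℝ)).symm.toLinearMap ∘ₗ X.mulVecLin

theorem fitMap_apply {n p : ℕ} (X : Matrix (Fin n) (Fin p) ℝ) (β : Fin p → ℝ) :
    fitMap X β = WithLp.toLp 2 (X.mulVec β) := rfl

theorem fitMap_single {n p : ℕ} (X : Matrix (Fin n) (Fin p) ℝ) (k : Fin p) (i : Fin n) :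
    fitMap X (Pi.single k 1) i = X i k := by
  simp [fitMap_apply]

theorem fitMap_injective {n p : ℕ} {X : Matrix (Fin n) (Fin p) ℝ} (hX : X.rank = p) :
    Function.Injective (fitMap X) := by
  have h : LinearMap.ker X.mulVecLin = ⊥ := by
    have h1 := X.mulVecLin.finrank_range_add_finrank_ker
    rw [← Matrix.rank, hX] at h1
    simp only [Module.finrank_fintype_fun_eq_card, Fintype.card_fin] at h1
    exact Submodule.finrank_eq_zero.1 (by omega)
  exact (WithLp.linearEquiv 2 ℝ (Fin n → ℝ)).symm.injective.comp (LinearMap.ker_eq_bot.1 h)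

/-! ### Existence, uniqueness and Lipschitz dependence on the response -/

theorem exists_isLassoEstimate {n p : ℕ} {X : Matrix (Fin n) (Fin p) ℝ} (hX : X.rank = p)
    {lam : ℝ} (hlam : 0 ≤ lam) (y : EuclideanSpace ℝ (Fin n)) :
    ∃ β, IsLassoEstimate X lam y β := by
  have hA : Continuous (fitMap X) := LinearMap.continuous_of_finiteDimensional _
  have hcont : Continuous (lassoObjective X lam y) := by
    unfold lassoObjective
    simp_rw [← fitMap_apply]
    fun_prop
  obtain ⟨K, -, hK⟩ := (fitMap X).exists_antilipschitzWith
    (LinearMap.ker_eq_bot.2 (fitMap_injective hX))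
  have hlim : Filter.Tendsto (lassoObjective X lam y) (Filter.cocompact _) Filter.atTop := by
    rw [← Metric.cobounded_eq_cocompact]
    have h1 := tendsto_norm_cobounded_atTop.comp hK.tendsto_cobounded
    have h2 : Filter.Tendsto (fun β => ‖fitMap X β‖ - ‖y‖) (Bornology.cobounded (Fin p → ℝ))
        Filter.atTop := Filter.tendsto_atTop_add_const_right _ _ h1
    have h3 := (Filter.tendsto_pow_atTop (α := ℝ) two_ne_zero).comp
      (Filter.tendsto_atTop_mono (fun β => (norm_sub_norm_le (fitMap X β) y).trans_eq
        (norm_sub_rev _ _)) h2)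
    refine Filter.tendsto_atTop_mono (fun β => ?_) h3
    exact le_add_of_nonneg_right (by positivity)
  exact hcont.exists_forall_le hlim

/-- Move from `β` a fraction `t` towards `γ`: the penalty is convex and the quadratic term is
`O(t²)`, so only first-order terms survive as `t → 0`. -/
theorem isLassoEstimate_iff {n p : ℕ} (X : Matrix (Fin n) (Fin p) ℝ) {lam : ℝ} (hlam : 0 ≤ lam)
    (y : EuclideanSpace ℝ (Fin n)) (β : Fin p → ℝ) :
    IsLassoEstimate X lam y β ↔ ∀ γ : Fin p → ℝ,
      2 * inner ℝ (y - fitMap X β) (fitMap X (γ - β)) ≤ lam * (∑ j, |γ j| - ∑ j, |β j|) := by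
  have key (γ : Fin p → ℝ) : lassoObjective X lam y γ = lassoObjective X lam y β
      - 2 * inner ℝ (y - fitMap X β) (fitMap X (γ - β)) + ‖fitMap X (γ - β)‖ ^ 2
      + lam * (∑ j, |γ j| - ∑ j, |β j|) := by
    have h : y - fitMap X γ = (y - fitMap X β) - fitMap X (γ - β) := by
      rw [map_sub]; abel
    simp only [lassoObjective, ← fitMap_apply]
    rw [h, norm_sub_sq_real]
    ring
  constructor
  · intro h γ
    refine le_of_forall_pos_le_add fun ε hε => ?_
    set N := ‖fitMap X (γ - β)‖ ^ 2
    have hN : 0 ≤ N := by positivity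
    -- `t ≤ 1` serves convexity; the other bound makes the quadratic remainder `t * N` at most `ε`.
    set t := min 1 (ε / (N + 1))
    have ht0 : 0 < t := by positivity
    have ht1 : t ≤ 1 := min_le_left _ _
    have htN : t * N ≤ ε := by
      have h1 : t * (N + 1) ≤ ε := (le_div_iff₀ (by positivity)).1 (min_le_right _ _)
      nlinarith
    have h1 := h (β + t • (γ - β))
    rw [key (β + t • (γ - β)), add_sub_cancel_left, map_smul, inner_smul_right, norm_smul,
      mul_pow, Real.norm_eq_abs, sq_abs] at h1
    have h2 : ∑ j, |(β + t • (γ - β)) j| - ∑ j, |β j| ≤ t * (∑ j, |γ j| - ∑ j, |β j|) := by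
      rw [← Finset.sum_sub_distrib, ← Finset.sum_sub_distrib, Finset.mul_sum]
      refine Finset.sum_le_sum fun j _ => ?_
      have h3 : (β + t • (γ - β)) j = (1 - t) * β j + t * γ j := by
        simp; ring
      have h4 := abs_add_le ((1 - t) * β j) (t * γ j)
      rw [abs_mul, abs_mul, abs_of_nonneg (sub_nonneg.2 ht1), abs_of_pos ht0] at h4
      rw [h3]
      linarith
    have h5 := mul_le_mul_of_nonneg_left h2 hlam
    have h6 : 0 ≤ t * (-(2 * inner ℝ (y - fitMap X β) (fitMap X (γ - β))) + t * N
        + lam * (∑ j, |γ j| - ∑ j, |β j|)) := by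
      linarith
    have h7 := nonneg_of_mul_nonneg_right h6 ht0
    linarith
  · intro h γ
    rw [key γ]
    have := h γ
    have : 0 ≤ ‖fitMap X (γ - β)‖ ^ 2 := by positivity
    linarith

/-- Testing each variational inequality at the other minimizer cancels the penalties on addition;
Cauchy–Schwarz finishes. -/
theorem IsLassoEstimate.norm_sub_le {n p : ℕ} {X : Matrix (Fin n) (Fin p) ℝ} {lam : ℝ}
    (hlam : 0 ≤ lam) {y y' : EuclideanSpace ℝ (Fin n)} {β β' : Fin p → ℝ}
    (h : IsLassoEstimate X lam y β) (h' : IsLassoEstimate X lam y' β') :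
    ‖fitMap X β - fitMap X β'‖ ≤ ‖y - y'‖ := by
  have h1 := (isLassoEstimate_iff X hlam y β).1 h β'
  have h2 := (isLassoEstimate_iff X hlam y' β').1 h' β
  rw [map_sub, ← neg_sub (fitMap X β) (fitMap X β'), inner_neg_right] at h1
  rw [map_sub] at h2
  have h3 : ‖fitMap X β - fitMap X β'‖ ^ 2 ≤ inner ℝ (y - y') (fitMap X β - fitMap X β') := by
    have h4 : inner ℝ (y' - fitMap X β') (fitMap X β - fitMap X β')
        = inner ℝ (y - fitMap X β) (fitMap X β - fitMap X β')
        - inner ℝ (y - y') (fitMap X β - fitMap X β')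
        + ‖fitMap X β - fitMap X β'‖ ^ 2 := by
      rw [← real_inner_self_eq_norm_sq, ← inner_sub_left, ← inner_add_left]
      congr 1
      abel
    linarith
  have h5 := real_inner_le_norm (y - y') (fitMap X β - fitMap X β')
  nlinarith [norm_nonneg (y - y'), norm_nonneg (fitMap X β - fitMap X β')]

theorem IsLassoEstimate.unique {n p : ℕ} {X : Matrix (Fin n) (Fin p) ℝ} (hX : X.rank = p)
    {lam : ℝ} (hlam : 0 ≤ lam) {y : EuclideanSpace ℝ (Fin n)} {β β' : Fin p → ℝ}
    (h : IsLassoEstimate X lam y β) (h' : IsLassoEstimate X lam y β') : β = β' := by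
  have h1 := h.norm_sub_le hlam h'
  rw [sub_self, norm_zero, norm_le_zero_iff, sub_eq_zero] at h1
  exact fitMap_injective hX h1

theorem isLassoEstimate_lassoCoef {n p : ℕ} {X : Matrix (Fin n) (Fin p) ℝ} (hX : X.rank = p)
    {lam : ℝ} (hlam : 0 ≤ lam) (y : EuclideanSpace ℝ (Fin n)) :
    IsLassoEstimate X lam y (lassoCoef X lam y) :=
  Classical.epsilon_spec (exists_isLassoEstimate hX hlam y)

theorem lipschitzWith_lassoFit {n p : ℕ} {X : Matrix (Fin n) (Fin p) ℝ} (hX : X.rank = p)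
    {lam : ℝ} (hlam : 0 ≤ lam) : LipschitzWith 1 (lassoFit X lam) :=
  LipschitzWith.of_dist_le_mul fun y y' => by
    rw [NNReal.coe_one, one_mul, dist_eq_norm, dist_eq_norm]
    exact (isLassoEstimate_lassoCoef hX hlam y).norm_sub_le hlam
      (isLassoEstimate_lassoCoef hX hlam y')

/-- The fit is Lipschitz and the injective map `fitMap X` has a bounded inverse on its range. -/
theorem exists_lipschitzWith_lassoCoef {n p : ℕ} {X : Matrix (Fin n) (Fin p) ℝ}
    (hX : X.rank = p) {lam : ℝ} (hlam : 0 ≤ lam) (k : Fin p) :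
    ∃ K, LipschitzWith K fun y => lassoCoef X lam y k := by
  obtain ⟨K, -, hK⟩ := (fitMap X).exists_antilipschitzWith
    (LinearMap.ker_eq_bot.2 (fitMap_injective hX))
  refine ⟨K, LipschitzWith.of_dist_le_mul fun y y' => ?_⟩
  calc dist (lassoCoef X lam y k) (lassoCoef X lam y' k)
      ≤ dist (lassoCoef X lam y) (lassoCoef X lam y') := dist_le_pi_dist _ _ k
    _ ≤ K * dist (lassoFit X lam y) (lassoFit X lam y') := hK.le_mul_dist _ _
    _ ≤ K * dist y y' := by
      gcongr
      simpa using (lipschitzWith_lassoFit hX hlam).dist_le_mul y y'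

/-! ### One coefficient along its own column -/

/-- Moving the response along the column `k` so that the `k`-th coefficient does not change sign
moves this coefficient alone, and by the same amount. -/
theorem IsLassoEstimate.add_smul_single {n p : ℕ} {X : Matrix (Fin n) (Fin p) ℝ} {lam : ℝ}
    (hlam : 0 ≤ lam) {y : EuclideanSpace ℝ (Fin n)} {β : Fin p → ℝ}
    (h : IsLassoEstimate X lam y β) (k : Fin p) {c : ℝ} (hc : -1 ≤ c) :
    IsLassoEstimate X lam (y + (c * β k) • fitMap X (Pi.single k 1))
      (β + (c * β k) • Pi.single k 1) := by
  -- Coordinate `k` is scaled by `1 + a ≥ 0`, so the penalty is linear in `a`.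
  have habs (a : ℝ) (ha : -1 ≤ a) :
      ∑ j, |(β + (a * β k) • (Pi.single k 1 : Fin p → ℝ)) j| - ∑ j, |β j| = a * |β k| := by
    rw [← Finset.sum_sub_distrib, Finset.sum_eq_single k]
    · have h1 : (β + (a * β k) • (Pi.single k 1 : Fin p → ℝ)) k = (1 + a) * β k := by
        simp; ring
      rw [h1, abs_mul, abs_of_nonneg (by linarith)]
      ring
    · intro j _ hj
      simp [hj]
    · simp
  rw [isLassoEstimate_iff X hlam] at h ⊢
  have hstep (a : ℝ) (ha : -1 ≤ a) :
      a * (2 * (β k * inner ℝ (y - fitMap X β) (fitMap X (Pi.single k 1))))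
        ≤ a * (lam * |β k|) := by
    have h1 := h (β + (a * β k) • Pi.single k 1)
    rw [habs a ha, add_sub_cancel_left, map_smul, inner_smul_right] at h1
    linarith
  -- The values `a = 1` and `a = -1` give opposite inequalities: stationarity in coordinate `k`,
  -- multiplied by `β k`.
  have heq : 2 * (β k * inner ℝ (y - fitMap X β) (fitMap X (Pi.single k 1))) = lam * |β k| := by
    have h1 := hstep 1 (by norm_num)
    have h2 := hstep (-1) le_rfl
    linarith
  intro γ
  have hres : y + (c * β k) • fitMap X (Pi.single k 1)
      - fitMap X (β + (c * β k) • Pi.single k 1) = y - fitMap X β := by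
    rw [map_add, map_smul]; abel
  have h1 := h γ
  have h2 := habs c hc
  rw [hres, ← sub_sub, map_sub, inner_sub_right, map_smul, inner_smul_right]
  have h3 : c * (2 * (β k * inner ℝ (y - fitMap X β) (fitMap X (Pi.single k 1))))
      = c * (lam * |β k|) := by rw [heq]
  have h4 : ∑ j, |γ j| - ∑ j, |(β + (c * β k) • (Pi.single k 1 : Fin p → ℝ)) j|
    = (∑ j, |γ j| - ∑ j, |β j|) - c * |β k| := by linarith
  rw [h4]
  linarith

theorem lassoCoef_add_smul_single {n p : ℕ} {X : Matrix (Fin n) (Fin p) ℝ} (hX : X.rank = p)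
    {lam : ℝ} (hlam : 0 ≤ lam) (y : EuclideanSpace ℝ (Fin n)) (k : Fin p) {c : ℝ}
    (hc : -1 ≤ c) :
    lassoCoef X lam (y + (c * lassoCoef X lam y k) • fitMap X (Pi.single k 1)) k
      = lassoCoef X lam y k + c * lassoCoef X lam y k := by
  have h := (isLassoEstimate_lassoCoef hX hlam y).add_smul_single hlam k hc
  rw [← h.unique hX hlam (isLassoEstimate_lassoCoef hX hlam _)]
  simp

/-- A function which, wherever it is nonzero, grows with slope one until it changes sign, has
derivative the indicator of its support almost everywhere. -/
theorem ae_hasDerivAt_indicator_support {φ : ℝ → ℝ}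
    (h : ∀ a c, -1 ≤ c → φ (a + c * φ a) = φ a + c * φ a) :
    ∀ᵐ t, HasDerivAt φ (if φ t = 0 then 0 else 1) t := by
  have hslope (a t : ℝ) (ha : φ a ≠ 0) (ht : -1 ≤ (t - a) / φ a) : φ t = φ a + (t - a) := by
    have := h a ((t - a) / φ a) ht
    rwa [div_mul_cancel₀ _ ha, add_sub_cancel] at this
  -- The zero set is an interval: a negative value only decreases to the left and a positive one
  -- only increases to the right. Its frontier is thus null.
  have hconn : {t | φ t = 0}.OrdConnected := by
    refine ⟨fun a ha b hb t ht => ?_⟩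
    by_contra hne
    have hne : φ t ≠ 0 := hne
    rcases lt_or_gt_of_ne hne with hneg | hpos
    · have h1 := hslope t a hne (le_trans (by norm_num)
        (div_nonneg_of_nonpos (sub_nonpos.2 ht.1) hneg.le))
      rw [show φ a = 0 from ha] at h1
      linarith [ht.1]
    · have h1 := hslope t b hne (le_trans (by norm_num)
        (div_nonneg (sub_nonneg.2 ht.2) hpos.le))
      rw [show φ b = 0 from hb] at h1
      linarith [ht.2]
  have hnull := (Set.OrdConnected.convex hconn (𝕜 := ℝ)).addHaar_frontier volume
  filter_upwards [compl_mem_ae_iff.2 hnull] with t ht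
  split_ifs with h0
  · have hint : t ∈ interior {t | φ t = 0} := by
      by_contra hni
      exact ht ⟨subset_closure h0, hni⟩
    refine (hasDerivAt_const t (0 : ℝ)).congr_of_eventuallyEq ?_
    filter_upwards [mem_interior_iff_mem_nhds.1 hint] with s hs using hs
  · have hev : ∀ᶠ s in nhds t, -1 < (s - t) / φ t := by
      have hc : ContinuousAt (fun s => (s - t) / φ t) t := by fun_prop
      exact hc.eventually_const_lt (by simp)
    refine (((hasDerivAt_id t).sub_const t).const_add (φ t)).congr_of_eventuallyEq ?_
    filter_upwards [hev] with s hs using hslope t s h0 hs.le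

theorem ae_hasDerivAt_lassoCoef {n p : ℕ} {X : Matrix (Fin n) (Fin p) ℝ} (hX : X.rank = p)
    {lam : ℝ} (hlam : 0 ≤ lam) (y : EuclideanSpace ℝ (Fin n)) (k : Fin p) :
    ∀ᵐ t : ℝ, HasDerivAt (fun t => lassoCoef X lam (y + t • fitMap X (Pi.single k 1)) k)
      (if lassoCoef X lam (y + t • fitMap X (Pi.single k 1)) k = 0 then 0 else 1) t := by
  refine ae_hasDerivAt_indicator_support fun a c hc => ?_
  have h := lassoCoef_add_smul_single hX hlam (y + a • fitMap X (Pi.single k 1)) k hc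
  rwa [add_assoc, ← add_smul] at h

/-! ### Stein's lemma -/

theorem LipschitzWith.memLp_of_memLp_id {E F : Type*} [NormedAddCommGroup E] [MeasurableSpace E]
    [OpensMeasurableSpace E] [SecondCountableTopology E] [NormedAddCommGroup F]
    {ν : Measure E} [IsFiniteMeasure ν] {q : ENNReal} (h : MemLp id q ν) {f : E → F}
    {K : NNReal} (hf : LipschitzWith K f) : MemLp f q ν := by
  refine ((memLp_const ‖f 0‖).add (h.norm.const_mul (K : ℝ))).of_le
    hf.continuous.aestronglyMeasurable (ae_of_all _ fun x => ?_)
  have h1 := hf.norm_sub_le x 0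
  have h2 := norm_add_le (f x - f 0) (f 0)
  rw [sub_add_cancel] at h2
  rw [sub_zero] at h1
  simp only [Pi.add_apply, id_eq, Real.norm_eq_abs]
  exact le_trans (by linarith) (le_abs_self _)

theorem hasDerivAt_gaussianPDFReal (m : ℝ) (s : NNReal) (t : ℝ) :
    HasDerivAt (gaussianPDFReal m s) (-((t - m) / s) * gaussianPDFReal m s t) t := by
  have h : HasDerivAt (fun x => (√(2 * Real.pi * s))⁻¹ * Real.exp (-(x - m) ^ 2 / (2 * s)))
      ((√(2 * Real.pi * s))⁻¹ * (Real.exp (-(t - m) ^ 2 / (2 * s)) *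
        (-((2 : ℕ) * (t - m) ^ (2 - 1) * 1) / (2 * s)))) t :=
    ((((((hasDerivAt_id t).sub_const m).pow 2).neg).div_const _).exp).const_mul _
  refine h.congr_deriv ?_
  have h2 : -((2 : ℕ) * (t - m) ^ (2 - 1) * 1) / (2 * (s : ℝ)) = -((t - m) / s) := by
    by_cases hs : (s : ℝ) = 0
    · simp [hs]
    · field_simp
      norm_num
      ring
  rw [h2, gaussianPDFReal]
  ring

theorem contDiff_gaussianPDFReal (m : ℝ) (s : NNReal) : ContDiff ℝ 1 (gaussianPDFReal m s) := by
  rw [gaussianPDFReal_def]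
  fun_prop

theorem LipschitzWith.tendsto_mul_gaussianPDFReal {φ : ℝ → ℝ} {K : NNReal}
    (hφ : LipschitzWith K φ) (m : ℝ) {s : NNReal} (hs : s ≠ 0) :
    Filter.Tendsto (fun t => φ t * gaussianPDFReal m s t) (Filter.cocompact ℝ) (nhds 0) := by
  have hs' : (0 : ℝ) < 1 / (2 * s) := by positivity
  have hsub : Filter.Tendsto (fun t : ℝ => t - m) (Filter.cocompact ℝ) (Filter.cocompact ℝ) :=
    (Homeomorph.subRight m).isClosedEmbedding.tendsto_cocompact
  have h0 := (tendsto_rpow_abs_mul_exp_neg_mul_sq_cocompact hs' 0).comp hsub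
  have h1 := (tendsto_rpow_abs_mul_exp_neg_mul_sq_cocompact hs' 1).comp hsub
  have h2 := ((h0.const_mul |φ m|).add (h1.const_mul (K : ℝ))).const_mul
    (√(2 * Real.pi * s))⁻¹
  simp only [mul_zero, add_zero] at h2
  refine squeeze_zero_norm (fun t => ?_) h2
  have h3 := hφ.norm_sub_le t m
  have h4 := norm_add_le (φ t - φ m) (φ m)
  rw [sub_add_cancel] at h4
  simp only [Real.norm_eq_abs] at h3 h4
  have h5 : -(1 / (2 * (s : ℝ))) * (t - m) ^ 2 = -(t - m) ^ 2 / (2 * s) := by ring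
  simp only [Function.comp_apply, Real.rpow_zero, Real.rpow_one, h5]
  rw [norm_mul, Real.norm_of_nonneg (gaussianPDFReal_nonneg m s t), Real.norm_eq_abs,
    gaussianPDFReal]
  have h6 : |φ t| ≤ |φ m| + K * |t - m| := by linarith
  calc _ ≤ (|φ m| + K * |t - m|)
        * ((√(2 * Real.pi * s))⁻¹ * Real.exp (-(t - m) ^ 2 / (2 * s))) := by gcongr
    _ = _ := by ring

/-- **Stein's lemma** in dimension one, for Lipschitz functions. -/
theorem LipschitzWith.integral_mul_sub_gaussianReal {φ ψ : ℝ → ℝ} {K : NNReal}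
    (hφ : LipschitzWith K φ) (m : ℝ) {s : NNReal} (hs : s ≠ 0)
    (hψ : ∀ᵐ t, HasDerivAt φ (ψ t) t) :
    ∫ t, φ t * (t - m) ∂gaussianReal m s = s * ∫ t, ψ t ∂gaussianReal m s := by
  have hs' : (s : ℝ) ≠ 0 := by exact_mod_cast hs
  have hψ' : ∫ t, ψ t ∂gaussianReal m s = ∫ t, deriv φ t ∂gaussianReal m s := by
    refine integral_congr_ae ?_
    filter_upwards [(gaussianReal_absolutelyContinuous m hs).ae_le hψ] with t ht
    exact ht.deriv.symm
  have hid : MemLp id 2 (gaussianReal m s) := by exact_mod_cast memLp_id_gaussianReal 2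
  have hint1 : Integrable (fun t => φ t * (t - m)) (gaussianReal m s) :=
    (hφ.memLp_of_memLp_id hid).integrable_mul (hid.sub (memLp_const m))
  have hint2 : Integrable (deriv φ) (gaussianReal m s) :=
    Integrable.of_bound (measurable_deriv φ).aestronglyMeasurable (K : ℝ)
      (ae_of_all _ fun t => norm_deriv_le_of_lipschitz hφ)
  -- Times the Gaussian density, `h` is the derivative of `φ` times that density; linear growth of
  -- `φ` kills the boundary terms.
  set h : ℝ → ℝ := fun t => deriv φ t - (s : ℝ)⁻¹ * (φ t * (t - m)) with hh
  have hint : Integrable h (gaussianReal m s) := hint2.sub (hint1.const_mul _)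
  have hvol : Integrable (fun t => gaussianPDFReal m s t • h t) := by
    rw [gaussianReal_of_var_ne_zero m hs, integrable_withDensity_iff_integrable_smul'
      (measurable_gaussianPDF m s) (ae_of_all _ fun _ => gaussianPDF_lt_top)] at hint
    simpa only [toReal_gaussianPDF] using hint
  have hlim := intervalIntegral_tendsto_integral hvol Filter.tendsto_neg_atTop_atBot
    Filter.tendsto_id
  have hIBP (R : ℝ) : ∫ t in (-R)..id R, gaussianPDFReal m s t • h t
      = φ R * gaussianPDFReal m s R - φ (-R) * gaussianPDFReal m s (-R) := by
    rw [← AbsolutelyContinuousOnInterval.integral_deriv_mul_eq_sub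
      (hφ.lipschitzOnWith (s := _)).absolutelyContinuousOnInterval
      (contDiff_gaussianPDFReal m s).contDiffOn.absolutelyContinuousOnInterval]
    refine intervalIntegral.integral_congr fun t _ => ?_
    simp only [hh, (hasDerivAt_gaussianPDFReal m s t).deriv, smul_eq_mul]
    field_simp
    ring
  have htend := hφ.tendsto_mul_gaussianPDFReal m hs
  have hzero : Filter.Tendsto (fun R => ∫ t in (-R)..id R, gaussianPDFReal m s t • h t)
      Filter.atTop (nhds 0) := by
    simp_rw [hIBP]
    rw [← sub_zero (0 : ℝ)]
    exact (htend.comp (Filter.tendsto_id.mono_right atTop_le_cocompact)).sub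
      (htend.comp (Filter.tendsto_neg_atTop_atBot.mono_right atBot_le_cocompact))
  have hfin := tendsto_nhds_unique hlim hzero
  rw [← integral_gaussianReal_eq_integral_smul hs, hh, integral_sub hint2 (hint1.const_mul _),
    integral_const_mul] at hfin
  rw [hψ', sub_eq_zero.1 hfin, mul_inv_cancel_left₀ hs']

/-- **Stein's lemma** along a direction `v`, for a Lipschitz function and an isotropic Gaussian
measure: the derivative is only needed almost everywhere on each line parallel to `v`. -/
theorem LipschitzWith.covariance_inner_of_isGaussian {E : Type*} [NormedAddCommGroup E]
    [InnerProductSpace ℝ E] [FiniteDimensional ℝ E] [MeasurableSpace E] [BorelSpace E]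
    {ν : Measure E} [IsGaussian ν] {c : ℝ} (hc : 0 < c)
    (hcov : ∀ x w : E, cov[fun y => inner ℝ x y, fun y => inner ℝ w y; ν] = c * inner ℝ x w)
    {g d : E → ℝ} {K : NNReal} (hg : LipschitzWith K g) (hd : Measurable d)
    {C : ℝ} (hdC : ∀ y, |d y| ≤ C) {v : E} (hv : v ≠ 0)
    (hderiv : ∀ y, ∀ᵐ t : ℝ, HasDerivAt (fun t : ℝ => g (y + t • v)) (d (y + t • v)) t) :
    cov[g, fun y => inner ℝ v y; ν] = c * ∫ y, d y ∂ν := by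
  have hv2 : ‖v‖ ^ 2 ≠ 0 := by positivity
  set T : E → ℝ := fun y => inner ℝ v y with hT
  -- `W` is the component orthogonal to `v`: uncorrelated with `T` and jointly Gaussian, hence
  -- independent of it. Fubini then reduces to dimension one for each fixed `W`.
  set W : E → E := fun y => y - (T y / ‖v‖ ^ 2) • v with hW
  set m : ℝ := ∫ y, T y ∂ν with hm
  set s : NNReal := (c * ‖v‖ ^ 2).toNNReal with hsdef
  have hs_coe : (s : ℝ) = c * ‖v‖ ^ 2 := Real.coe_toNNReal _ (by positivity)
  have hs : s ≠ 0 := by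
    rw [← NNReal.coe_ne_zero, hs_coe]
    positivity
  have hTm : Measurable T := by fun_prop
  have hWm : Measurable W := by fun_prop
  have hlawT : ν.map T = gaussianReal m s := by
    have h := IsGaussian.map_eq_gaussianReal (μ := ν) (innerSL ℝ v)
    have hvar : Var[T; ν] = c * ‖v‖ ^ 2 := by
      rw [← covariance_self hTm.aemeasurable, hcov, real_inner_self_eq_norm_sq]
    rw [hm, hsdef, ← hvar]
    exact h
  have hind : T ⟂ᵢ[ν] W := by
    let L : E →L[ℝ] ℝ × E := (innerSL ℝ v).prod
      (ContinuousLinearMap.id ℝ E - ((‖v‖ ^ 2)⁻¹ • innerSL ℝ v).smulRight v)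
    have hL : HasGaussianLaw (fun y => (T y, W y)) ν := by
      have h := (IsGaussian.hasGaussianLaw_id (μ := ν)).map_fun L
      have hL' : (fun y => L (id y)) = fun y => (T y, W y) := by
        funext y
        refine Prod.ext rfl ?_
        change y - ((‖v‖ ^ 2)⁻¹ * inner ℝ v y) • v = y - (inner ℝ v y / ‖v‖ ^ 2) • v
        rw [div_eq_inv_mul]
      rwa [hL'] at h
    refine hL.indepFun_of_covariance_inner fun x w => ?_
    have h1 : (fun y => inner ℝ x (T y)) = fun y => x * inner ℝ v y := by
      ext y
      simp [hT, mul_comm]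
    have h2 : (fun y => inner ℝ w (W y))
        = fun y => inner ℝ (w - (inner ℝ w v / ‖v‖ ^ 2) • v) y := by
      ext y
      change inner ℝ w (y - (inner ℝ v y / ‖v‖ ^ 2) • v)
        = inner ℝ (w - (inner ℝ w v / ‖v‖ ^ 2) • v) y
      rw [inner_sub_right, inner_sub_left, real_inner_smul_left, real_inner_smul_right]
      ring
    rw [h1, h2, covariance_const_mul_left, hcov, inner_sub_right, inner_smul_right,
      real_inner_self_eq_norm_sq, real_inner_comm, div_mul_cancel₀ _ hv2, sub_self, mul_zero,
      mul_zero]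
  have hprod := (indepFun_iff_map_prod_eq_prod_map_map hTm.aemeasurable hWm.aemeasurable).1 hind
  rw [hlawT] at hprod
  have hrec (y : E) : W y + (T y / ‖v‖ ^ 2) • v = y := sub_add_cancel _ _
  have hTWm : Measurable fun y => (T y, W y) := hTm.prodMk hWm
  have hPW : IsProbabilityMeasure (ν.map W) := Measure.isProbabilityMeasure_map hWm.aemeasurable
  have hid : MemLp id 2 ν := IsGaussian.memLp_two_id
  -- Centring makes the covariance literally the integral of `g₀ y * (T y - m)`.
  set g₀ : E → ℝ := fun y => g y - ∫ z, g z ∂ν with hg0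
  have hg0L : LipschitzWith K g₀ := LipschitzWith.of_dist_le_mul fun y y' => by
    simpa [hg0] using hg.dist_le_mul y y'
  have hTL : MemLp T 2 ν := hid.const_inner v
  have hgT : Integrable (fun y => g₀ y * (T y - m)) ν :=
    (hg0L.memLp_of_memLp_id hid).integrable_mul (hTL.sub (memLp_const m))
  have hpm : Measurable fun q : ℝ × E => q.2 + (q.1 / ‖v‖ ^ 2) • v := by fun_prop
  have hgc : Measurable fun q : ℝ × E =>
      g₀ (q.2 + (q.1 / ‖v‖ ^ 2) • v) * (q.1 - m) :=
    (hg0L.continuous.measurable.comp hpm).mul (by fun_prop)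
  have hdc : Measurable fun q : ℝ × E => d (q.2 + (q.1 / ‖v‖ ^ 2) • v) := hd.comp hpm
  have hgi : Integrable (fun q : ℝ × E => g₀ (q.2 + (q.1 / ‖v‖ ^ 2) • v) * (q.1 - m))
      ((gaussianReal m s).prod (ν.map W)) := by
    rw [← hprod, integrable_map_measure hgc.aestronglyMeasurable hTWm.aemeasurable]
    simpa only [Function.comp_def, hrec] using hgT
  have hdi : Integrable (fun q : ℝ × E => d (q.2 + (q.1 / ‖v‖ ^ 2) • v))
      ((gaussianReal m s).prod (ν.map W)) :=
    Integrable.of_bound hdc.aestronglyMeasurable C (ae_of_all _ fun q => hdC _)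
  have h1 : cov[g, T; ν] = ∫ w, ∫ t, g₀ (w + (t / ‖v‖ ^ 2) • v) * (t - m) ∂gaussianReal m s
      ∂ν.map W := by
    rw [← integral_prod_symm _ hgi, ← hprod,
      integral_map hTWm.aemeasurable hgc.aestronglyMeasurable]
    simp only [hrec]
    rfl
  have h2 : ∫ y, d y ∂ν = ∫ w, ∫ t, d (w + (t / ‖v‖ ^ 2) • v) ∂gaussianReal m s ∂ν.map W := by
    rw [← integral_prod_symm _ hdi, ← hprod,
      integral_map hTWm.aemeasurable hdc.aestronglyMeasurable]
    simp only [hrec]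
  rw [h1, h2, ← integral_const_mul]
  congr 1 with w
  have hline : LipschitzWith (K * (‖v‖₊ / ‖v‖₊ ^ 2)) fun t : ℝ => g₀ (w + (t / ‖v‖ ^ 2) • v) := by
    refine hg0L.comp (LipschitzWith.of_dist_le_mul fun t t' => ?_)
    rw [dist_add_left, dist_eq_norm, ← sub_smul, ← sub_div, norm_smul, norm_div, dist_eq_norm]
    simp
    ring_nf
    rfl
  -- The chain-rule factor `1 / ‖v‖ ^ 2` will cancel against the variance `c * ‖v‖ ^ 2`.
  have hder : ∀ᵐ t : ℝ, HasDerivAt (fun t : ℝ => g₀ (w + (t / ‖v‖ ^ 2) • v))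
      (d (w + (t / ‖v‖ ^ 2) • v) * (1 / ‖v‖ ^ 2)) t := by
    have hq : Measure.QuasiMeasurePreserving (fun t : ℝ => t / ‖v‖ ^ 2) volume volume := by
      have hne : (‖v‖ ^ 2)⁻¹ ≠ 0 := inv_ne_zero hv2
      refine ⟨by fun_prop, ?_⟩
      simp_rw [div_eq_mul_inv]
      rw [Real.map_volume_mul_right hne]
      exact Measure.smul_absolutelyContinuous
    filter_upwards [hq.ae (hderiv w)] with t ht
    exact (HasDerivAt.comp t ht ((hasDerivAt_id t).div_const _)).sub_const _
  rw [hline.integral_mul_sub_gaussianReal m hs hder, integral_mul_const, hs_coe]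
  field_simp

/-! ### Degrees of freedom -/

theorem covariance_inner_multivariateGaussian_smul_one {n : ℕ} (μ : EuclideanSpace ℝ (Fin n))
    (σ : ℝ) (x w : EuclideanSpace ℝ (Fin n)) :
    cov[fun y => inner ℝ x y, fun y => inner ℝ w y;
      multivariateGaussian μ (σ ^ 2 • (1 : Matrix (Fin n) (Fin n) ℝ))] = σ ^ 2 * inner ℝ x w := by
  rw [← covarianceBilin_apply_eq_cov IsGaussian.memLp_two_id,
    covarianceBilin_multivariateGaussian (Matrix.PosSemidef.one.smul (sq_nonneg σ))]
  simp [Matrix.smul_mulVec, PiLp.inner_apply, dotProduct, Finset.mul_sum, mul_comm,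
    mul_left_comm]

theorem covariance_lassoCoef {n p : ℕ} {X : Matrix (Fin n) (Fin p) ℝ} (hX : X.rank = p)
    {lam : ℝ} (hlam : 0 ≤ lam) (μ : EuclideanSpace ℝ (Fin n)) {σ : ℝ} (hσ : 0 < σ) (k : Fin p) :
    cov[fun y => lassoCoef X lam y k, fun y => inner ℝ (fitMap X (Pi.single k 1)) y;
      multivariateGaussian μ (σ ^ 2 • (1 : Matrix (Fin n) (Fin n) ℝ))]
    = σ ^ 2 * ∫ y, (if lassoCoef X lam y k = 0 then (0 : ℝ) else 1)
      ∂multivariateGaussian μ (σ ^ 2 • (1 : Matrix (Fin n) (Fin n) ℝ)) := by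
  obtain ⟨K, hK⟩ := exists_lipschitzWith_lassoCoef hX hlam k
  have hv : fitMap X (Pi.single k 1) ≠ 0 := by
    rw [← map_zero (fitMap X)]
    exact (fitMap_injective hX).ne (by simp)
  have hd : Measurable fun y => if lassoCoef X lam y k = 0 then (0 : ℝ) else 1 :=
    Measurable.ite (hK.continuous.measurable (measurableSet_singleton 0))
      measurable_const measurable_const
  exact hK.covariance_inner_of_isGaussian (pow_pos hσ 2)
    (covariance_inner_multivariateGaussian_smul_one μ σ) hd (C := 1)
    (fun y => by split_ifs <;> simp) hv fun y => ae_hasDerivAt_lassoCoef hX hlam y k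

theorem lassoFit_apply {n p : ℕ} (X : Matrix (Fin n) (Fin p) ℝ) (lam : ℝ)
    (y : EuclideanSpace ℝ (Fin n)) (i : Fin n) :
    lassoFit X lam y i = ∑ k, X i k * lassoCoef X lam y k := rfl

theorem card_lassoActiveSet {n p : ℕ} (X : Matrix (Fin n) (Fin p) ℝ) (lam : ℝ)
    (y : EuclideanSpace ℝ (Fin n)) :
    ((lassoActiveSet X lam y).card : ℝ)
      = ∑ k, if lassoCoef X lam y k = 0 then (0 : ℝ) else 1 := by
  rw [lassoActiveSet, Finset.card_filter]
  push_cast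
  exact Finset.sum_congr rfl fun k _ => by split_ifs <;> simp_all

theorem theorem1 {n p : ℕ} (X : Matrix (Fin n) (Fin p) ℝ) (hX : X.rank = p)
    (lam : ℝ) (hlam : 0 ≤ lam) :
    (∀ y, ∃! β, IsLassoEstimate X lam y β) ∧
    LipschitzWith 1 (lassoFit X lam) ∧
    ∀ {Ω : Type*} [MeasurableSpace Ω] (P : Measure Ω) [IsProbabilityMeasure P]
      (μ : EuclideanSpace ℝ (Fin n)) (σ : ℝ) (_ : 0 < σ)
      (y : Ω → EuclideanSpace ℝ (Fin n))
      (_ : HasLaw y (multivariateGaussian μ (σ ^ 2 • (1 : Matrix (Fin n) (Fin n) ℝ))) P),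
      (∀ i, MemLp (fun ω => y ω i) 2 P) ∧
      (∀ i, MemLp (fun ω => lassoFit X lam (y ω) i) 2 P) ∧
      Integrable (fun ω => ((lassoActiveSet X lam (y ω)).card : ℝ)) P ∧
      degreesOfFreedom P σ (lassoFit X lam) y =
        ∫ ω, ((lassoActiveSet X lam (y ω)).card : ℝ) ∂P := by
  refine ⟨fun y => ⟨_, isLassoEstimate_lassoCoef hX hlam y, fun β hβ =>
    hβ.unique hX hlam (isLassoEstimate_lassoCoef hX hlam y)⟩, lipschitzWith_lassoFit hX hlam, ?_⟩
  intro Ω _ P _ μ σ hσ y hy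
  set ν := multivariateGaussian μ (σ ^ 2 • (1 : Matrix (Fin n) (Fin n) ℝ)) with hν
  have hid : MemLp id 2 ν := IsGaussian.memLp_two_id
  have hfit : Continuous (lassoFit X lam) := (lipschitzWith_lassoFit hX hlam).continuous
  have hcoef (k : Fin p) : Continuous fun y => lassoCoef X lam y k :=
    (exists_lipschitzWith_lassoCoef hX hlam k).choose_spec.continuous
  have hmem {f : EuclideanSpace ℝ (Fin n) → ℝ} (hf : MemLp f 2 ν) :
      MemLp (fun ω => f (y ω)) 2 P :=
    (memLp_map_measure_iff (hy.map_eq ▸ hf.1) hy.aemeasurable).1 (hy.map_eq ▸ hf)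
  have hevalL : ∀ i, MemLp (fun z : EuclideanSpace ℝ (Fin n) => z i) 2 ν := fun i =>
    hid.of_le (by fun_prop) (ae_of_all _ fun z => PiLp.norm_apply_le z i)
  have hfitL : ∀ i, MemLp (fun z => lassoFit X lam z i) 2 ν := fun i =>
    ((lipschitzWith_lassoFit hX hlam).memLp_of_memLp_id hid).of_le (by fun_prop)
      (ae_of_all _ fun z => PiLp.norm_apply_le _ i)
  have hcoefL : ∀ k, MemLp (fun z => lassoCoef X lam z k) 2 ν := fun k =>
    (exists_lipschitzWith_lassoCoef hX hlam k).choose_spec.memLp_of_memLp_id hid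
  have hindM (k : Fin p) :
      Measurable fun z => if lassoCoef X lam z k = 0 then (0 : ℝ) else 1 :=
    Measurable.ite ((hcoef k).measurable (measurableSet_singleton 0))
      measurable_const measurable_const
  have hindI (k : Fin p) :
      Integrable (fun z => if lassoCoef X lam z k = 0 then (0 : ℝ) else 1) ν :=
    Integrable.of_bound (hindM k).aestronglyMeasurable 1
      (ae_of_all _ fun z => by split_ifs <;> simp)
  have hcardI : Integrable (fun z => ((lassoActiveSet X lam z).card : ℝ)) ν := by
    simp_rw [card_lassoActiveSet]
    exact integrable_finsetSum _ fun k _ => hindI k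
  refine ⟨fun i => hmem (hevalL i), fun i => hmem (hfitL i), ?_, ?_⟩
  · exact (integrable_map_measure (hy.map_eq ▸ hcardI.1) hy.aemeasurable).1
      (hy.map_eq ▸ hcardI)
  have hRHS : ∫ ω, ((lassoActiveSet X lam (y ω)).card : ℝ) ∂P
      = ∑ k, ∫ z, (if lassoCoef X lam z k = 0 then (0 : ℝ) else 1) ∂ν := by
    rw [← integral_finsetSum _ fun k _ => hindI k]
    simp_rw [← card_lassoActiveSet]
    exact hy.integral_comp hcardI.1
  have hcov (i : Fin n) : cov[fun ω => lassoFit X lam (y ω) i, fun ω => y ω i; P]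
      = ∑ k, cov[fun z => lassoCoef X lam z k, fun z => X i k * z i; ν] := by
    rw [hy.covariance_fun_comp (f := fun z => lassoFit X lam z i) (g := fun z => z i)
      (by fun_prop) (by fun_prop)]
    simp_rw [lassoFit_apply]
    rw [covariance_fun_sum_left (fun k => (hcoefL k).const_mul _) (hevalL i)]
    simp_rw [covariance_const_mul_left, covariance_const_mul_right]
  have hinner (k : Fin p) : (fun z => ∑ i, X i k * z i)
      = fun z => inner ℝ (fitMap X (Pi.single k 1)) z := by
    ext z
    simp [PiLp.inner_apply, fitMap_single, mul_comm]
  rw [degreesOfFreedom, hRHS, ← Finset.sum_div, div_eq_iff (by positivity), Finset.sum_mul]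
  simp_rw [hcov]
  -- Summing over `i` first assembles `X i k * z i` into the inner product with column `k`.
  rw [Finset.sum_comm]
  refine Finset.sum_congr rfl fun k _ => ?_
  rw [← covariance_fun_sum_right (fun i => (hevalL i).const_mul _) (hcoefL k), hinner k,
    covariance_lassoCoef hX hlam μ hσ k, mul_comm]
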